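/- Let $m\ge 1$ be an integer and let $A$ be a unital C*-algebra. For self-adjoint elements $a,b$ of a unital C*-algebra write $a<b$ if $b-a\ge\delta 1$ for some scalar $\delta>0$. We say that $A$ has the $m$-partition of unity property if for all self-adjoint $b_1,\dots,b_m\in A$ with $0<b_k<1$ for every $k$ there are a positive integer $n$, a positive element $[a_{ij}]\in M_n(A)$ with $a_{11}+\cdots+a_{nn}=1$, and matrices $C_k=[c^k_{ij}]\in M_n(\mathbb C)$, $k=1,\dots,m$, with $0<C_k<I_n$, such that $b_k=\sum_{i,j=1}^n c^k_{ij}a_{ij}$ for $k=1,\dots,m$. Let $\mathcal W_{2,m}\subset\ell^\infty_{2m}$ be the operator system $$\mathcal W_{2,m}=\{(x_1,\dots,x_{2m})\in\ell^\infty_{2m}:\ x_1+x_2=x_3+x_4=\cdots=x_{2m-1}+x_{2m}\},$$ that is, the span of $w_0=(1,\dots,1)$, $w_1=(1,-1,0,\dots,0)$, $w_2=(0,0,1,-1,0,\dots,0)$, $\dots$, $w_m=(0,\dots,0,1,-1)$. Here $[x_{ij}]\in M_p(\mathcal W_{2,m})$ is positive if it is positive in $M_p(\ell^\infty_{2m})$,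 and the unit is $w_0$. For operator systems $\mathcal S,\mathcal T$ let $D_1^{\max}\subset\mathcal S\otimes\mathcal T$ be the set of all $X^*(S\otimes T)X$ with $S\in M_p(\mathcal S)^+$, $T\in M_q(\mathcal T)^+$, $X$ a scalar $pq\times 1$ matrix and $p,q\in\mathbb N$. An element $u$ of the algebraic tensor product $\mathcal S\otimes\mathcal T$ is positive in the maximal tensor product $\mathcal S\otimes_{\max}\mathcal T$ if $u+\varepsilon(1\otimes 1)\in D_1^{\max}$ for every $\varepsilon>0$. Then $A$ has the $m$-partition of unity property if and only if $\mathcal W_{2,m}\otimes_{\max}A\subset\ell^\infty_{2m}\otimes A$ order isomorphically, i.e. if and only if the canonical map $i\otimes\mathrm{id}:\mathcal W_{2,m}\otimes A\to\ell^\infty_{2m}\otimes A$ is injective and an element $u\in\mathcal W_{2,m}\otimes A$ is positive in $\mathcal W_{2,m}\otimes_{\max}A$ if and only if $(i\otimes\mathrm{id})(u)$ is positive in the C*-algebra $\ell^\infty_{2m}\otimes A$. -/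

import Mathlib

open scoped TensorProduct ComplexOrder

/-! ### Abstract operator systems -/

/-- The compression `X* x X` of a square matrix `x` over a complex vector space by a rectangular
scalar matrix `X`. -/
def compress {V ι κ : Type*} [AddCommGroup V] [Module ℂ V] [Fintype ι]
    (X : Matrix ι κ ℂ) (x : Matrix ι ι V) : Matrix κ κ V :=
  Matrix.of fun i j => ∑ k, ∑ l, (star (X k i) * X l j) • x k l

/-- An (abstract) operator system: a complex `*`-vector space `V` with a proper compatible family
of cones `cone n` of self-adjoint elements of `M_n(V)`, and an Archimedean matrix order unit. -/
class OperatorSystem (V : Type*) [AddCommGroup V] [Module ℂ V] [StarAddMonoid V]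
    [StarModule ℂ V] where
  /-- the positive elements of `M_n(V)` -/
  cone (n : ℕ) : Set (Matrix (Fin n) (Fin n) V)
  /-- the Archimedean matrix order unit -/
  unit : V
  conjTranspose_eq {n : ℕ} {x : Matrix (Fin n) (Fin n) V} : x ∈ cone n → x.conjTranspose = x
  zero_mem (n : ℕ) : 0 ∈ cone n
  add_mem {n : ℕ} {x y : Matrix (Fin n) (Fin n) V} : x ∈ cone n → y ∈ cone n → x + y ∈ cone n
  compress_mem {n m : ℕ} (X : Matrix (Fin n) (Fin m) ℂ) {x : Matrix (Fin n) (Fin n) V} :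
    x ∈ cone n → compress X x ∈ cone m
  proper {n : ℕ} {x : Matrix (Fin n) (Fin n) V} : x ∈ cone n → -x ∈ cone n → x = 0
  star_unit : star unit = unit
  exists_add_mem {n : ℕ} {x : Matrix (Fin n) (Fin n) V} : x.conjTranspose = x →
    ∃ r : ℝ, 0 < r ∧ (r : ℂ) • Matrix.diagonal (fun _ => unit) + x ∈ cone n
  archimedean {n : ℕ} {x : Matrix (Fin n) (Fin n) V} :
    (∀ ε : ℝ, 0 < ε → x + (ε : ℂ) • Matrix.diagonal (fun _ => unit) ∈ cone n) → x ∈ cone n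

lemma exists_eq_star_mul_self_of_nonneg {B : Type*} [CStarAlgebra B] [PartialOrder B]
    [StarOrderedRing B] {x : B} (hx : 0 ≤ x) : ∃ y, x = star y * y :=
  CStarAlgebra.nonneg_iff_eq_star_mul_self.mp hx

lemma conjTranspose_mul_self_nonneg_of_rect {A : Type*} [CStarAlgebra A] [PartialOrder A]
    [StarOrderedRing A] {n m : ℕ} (M : Matrix (Fin n) (Fin m) A) :
    0 ≤ CStarMatrix.ofMatrix (M.conjTranspose * M) := by
  rcases m with _ | m
  · exact le_of_eq (by ext i; exact i.elim0)
  · let N : Fin n → CStarMatrix (Fin (m + 1)) (Fin (m + 1)) A := fun k =>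
      CStarMatrix.ofMatrix (Matrix.of fun i j => if i = 0 then M k j else 0)
    have h : CStarMatrix.ofMatrix (M.conjTranspose * M) = ∑ k, star (N k) * N k := by
      have h' : (M.conjTranspose * M : Matrix (Fin (m + 1)) (Fin (m + 1)) A) =
          ∑ k, (Matrix.of fun i j => if i = 0 then M k j else 0 :
            Matrix (Fin (m + 1)) (Fin (m + 1)) A).conjTranspose *
            (Matrix.of fun i j => if i = 0 then M k j else 0) := by
        ext i j
        simp only [Matrix.sum_apply, Matrix.mul_apply, Matrix.conjTranspose_apply, Matrix.of_apply]
        refine Finset.sum_congr rfl fun k _ => ?_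
        rw [Finset.sum_eq_single 0] <;> simp +contextual
      exact h'
    rw [h]
    exact Finset.sum_nonneg fun k _ => star_mul_self_nonneg _

/-- A unital C*-algebra is an operator system: the cone of `M_n(A)` is the positive cone of the
C*-algebra `M_n(A)`. -/
noncomputable instance CStarAlgebra.instOperatorSystem (A : Type*) [CStarAlgebra A]
    [PartialOrder A] [StarOrderedRing A] : OperatorSystem A where
  cone n := {x | 0 ≤ CStarMatrix.ofMatrix x}
  unit := 1
  conjTranspose_eq {n x} hx := by
    have hx' : 0 ≤ CStarMatrix.ofMatrix x := hx
    exact (IsSelfAdjoint.of_nonneg hx').star_eq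
  zero_mem n := le_refl (0 : CStarMatrix (Fin n) (Fin n) A)
  add_mem {n x y} hx hy :=
    add_nonneg (a := CStarMatrix.ofMatrix x) (b := CStarMatrix.ofMatrix y) hx hy
  compress_mem {n m} X {x} hx := by
    have hx' : 0 ≤ CStarMatrix.ofMatrix x := hx
    obtain ⟨y, hy⟩ := exists_eq_star_mul_self_of_nonneg hx'
    let z : Matrix (Fin n) (Fin n) A := CStarMatrix.ofMatrix.symm y
    have hz : x = z.conjTranspose * z := hy
    have key := conjTranspose_mul_self_nonneg_of_rect (z * X.map (algebraMap ℂ A))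
    have e : compress X x =
        (z * X.map (algebraMap ℂ A)).conjTranspose * (z * X.map (algebraMap ℂ A)) := by
      rw [Matrix.conjTranspose_mul, Matrix.mul_assoc, ← Matrix.mul_assoc _ _ (X.map _), ← hz]
      ext i j
      simp only [compress, Matrix.of_apply, Matrix.mul_apply, Matrix.conjTranspose_apply,
        Matrix.map_apply, Finset.mul_sum]
      refine Finset.sum_congr rfl fun k _ => Finset.sum_congr rfl fun l _ => ?_
      rw [← Algebra.commutes (X l j), ← algebraMap_star_comm, Algebra.smul_def, map_mul, mul_assoc]
    rw [Set.mem_ofPred_eq, e]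
    exact key
  proper {n x} hx hx' :=
    le_antisymm (a := CStarMatrix.ofMatrix x) (b := 0) (neg_nonneg.mp hx') hx
  star_unit := star_one A
  exists_add_mem {n x} hx := by
    have hx' : IsSelfAdjoint (CStarMatrix.ofMatrix x) := hx
    have h := hx'.neg_algebraMap_norm_le_self
    refine ⟨‖CStarMatrix.ofMatrix x‖ + 1, by positivity, ?_⟩
    have e : (CStarMatrix.ofMatrix
        (((‖CStarMatrix.ofMatrix x‖ + 1 : ℝ) : ℂ) • Matrix.diagonal (fun _ => (1 : A)) + x)) =
        algebraMap ℝ (CStarMatrix (Fin n) (Fin n) A) (‖CStarMatrix.ofMatrix x‖ + 1) +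
          CStarMatrix.ofMatrix x := by
      have h1 : (CStarMatrix.ofMatrix (Matrix.diagonal (fun _ => (1 : A))) :
          CStarMatrix (Fin n) (Fin n) A) = 1 := rfl
      rw [Algebra.algebraMap_eq_smul_one, ← h1]
      ext i j
      exact congrArg (· + x i j) (Complex.coe_smul (‖CStarMatrix.ofMatrix x‖ + 1)
        (Matrix.diagonal (fun _ => (1 : A)) i j))
    rw [Set.mem_ofPred_eq, e, map_add, map_one, add_right_comm]
    exact add_nonneg (neg_le_iff_add_nonneg'.mp h) zero_le_one
  archimedean {n x} h := by
    have hc : IsClosed {a : CStarMatrix (Fin n) (Fin n) A | 0 ≤ a} :=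
      CStarAlgebra.isClosed_nonneg
    have ht : Filter.Tendsto (fun ε : ℝ => CStarMatrix.ofMatrix x +
        (ε : ℂ) • (1 : CStarMatrix (Fin n) (Fin n) A)) (nhdsWithin 0 (Set.Ioi 0))
        (nhds (CStarMatrix.ofMatrix x)) := by
      have : Continuous (fun ε : ℝ => CStarMatrix.ofMatrix x +
        (ε : ℂ) • (1 : CStarMatrix (Fin n) (Fin n) A)) := by fun_prop
      simpa using (this.tendsto 0).mono_left nhdsWithin_le_nhds
    exact hc.mem_of_tendsto ht (by
      filter_upwards [self_mem_nhdsWithin] with ε hε using h ε hε)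

/-- The operator system structure induced on `V` by an injective `*`-linear map `j : V → T` into an
operator system `T` whose range contains the order unit: `x ∈ M_n(V)` is positive if and only if
the matrix `(j (x_{ij}))` is positive in `M_n(T)`. -/
@[reducible] def OperatorSystem.induced {V T : Type*} [AddCommGroup V] [Module ℂ V]
    [StarAddMonoid V] [StarModule ℂ V] [AddCommGroup T] [Module ℂ T] [StarAddMonoid T]
    [StarModule ℂ T] [OperatorSystem T] (j : V →ₗ[ℂ] T) (hj : Function.Injective j)
    (hstar : ∀ v, j (star v) = star (j v)) (e : V) (he : j e = OperatorSystem.unit) :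
    OperatorSystem V where
  cone n := {x | x.map j ∈ OperatorSystem.cone n}
  unit := e
  conjTranspose_eq {n x} hx := by
    have h := OperatorSystem.conjTranspose_eq hx
    ext i k
    apply hj
    have := congrFun (congrFun h i) k
    simpa [hstar] using this
  zero_mem n := by
    have : (0 : Matrix (Fin n) (Fin n) V).map j = 0 := by ext; simp
    simpa [this] using OperatorSystem.zero_mem (V := T) n
  add_mem {n x y} hx hy := by
    have : (x + y).map j = x.map j + y.map j := by ext; simp
    simpa [this] using OperatorSystem.add_mem hx hy
  compress_mem {n m} X {x} hx := by
    have : (compress X x).map j = compress X (x.map j) := by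
      ext; simp [compress]
    simpa [this] using OperatorSystem.compress_mem X hx
  proper {n x} hx hx' := by
    have e : (-x).map j = -(x.map j) := by ext; simp
    have h := OperatorSystem.proper hx (by simpa [e] using hx')
    ext i k
    apply hj
    simpa using congrFun (congrFun h i) k
  star_unit := hj (by rw [hstar, he, OperatorSystem.star_unit])
  exists_add_mem {n x} hx := by
    have hx' : (x.map j).conjTranspose = x.map j := by
      ext i k
      have := congrArg j (congrFun (congrFun hx i) k)
      simpa [hstar] using this
    obtain ⟨r, hr, h⟩ := OperatorSystem.exists_add_mem hx'
    refine ⟨r, hr, ?_⟩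
    have e' : ((r : ℂ) • Matrix.diagonal (fun _ => e) + x).map j =
        (r : ℂ) • Matrix.diagonal (fun _ => OperatorSystem.unit) + x.map j := by
      ext i k
      by_cases hik : i = k <;> simp [hik, he]
    rw [Set.mem_ofPred_eq, e']
    exact h
  archimedean {n x} h := by
    refine OperatorSystem.archimedean fun ε hε => ?_
    have e' : (x + (ε : ℂ) • Matrix.diagonal (fun _ => e)).map j =
        x.map j + (ε : ℂ) • Matrix.diagonal (fun _ => OperatorSystem.unit) := by
      ext i k
      by_cases hik : i = k <;> simp [hik, he]
    rw [← e']
    exact h ε hε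

/-! ### The maximal tensor product of operator systems -/

section MaxTensor

variable (S T : Type*) [AddCommGroup S] [Module ℂ S] [StarAddMonoid S] [StarModule ℂ S]
  [OperatorSystem S] [AddCommGroup T] [Module ℂ T] [StarAddMonoid T] [StarModule ℂ T]
  [OperatorSystem T]

/-- The cone `D_n^max` of all `X* (s ⊗ t) X` with `s ∈ M_p(S)` and `t ∈ M_q(T)` positive and `X` a
scalar `pq × n` matrix. -/
def maxPreCone (n : ℕ) : Set (Matrix (Fin n) (Fin n) (S ⊗[ℂ] T)) :=
  {u | ∃ (p q : ℕ) (s : Matrix (Fin p) (Fin p) S) (t : Matrix (Fin q) (Fin q) T)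
    (X : Matrix (Fin p × Fin q) (Fin n) ℂ),
    s ∈ OperatorSystem.cone p ∧ t ∈ OperatorSystem.cone q ∧
      u = compress X (Matrix.of fun (i j : Fin p × Fin q) => s i.1 j.1 ⊗ₜ[ℂ] t i.2 j.2)}

/-- The cone `C_n^max` of positive elements of `M_n(S ⊗_max T)`, the Archimedeanization of
`D_n^max`. -/
def maxCone (n : ℕ) : Set (Matrix (Fin n) (Fin n) (S ⊗[ℂ] T)) :=
  {u | ∀ ε : ℝ, 0 < ε →
    u + (ε : ℂ) • Matrix.diagonal
      (fun _ => (OperatorSystem.unit : S) ⊗ₜ[ℂ] (OperatorSystem.unit : T)) ∈ maxPreCone S T n}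

variable {S T}

/-- Positivity of an element of `S ⊗_max T`, identified with a `1 × 1` matrix. -/
def IsMaxPositive (u : S ⊗[ℂ] T) : Prop :=
  (Matrix.of fun _ _ => u) ∈ maxCone S T 1

end MaxTensor

/-! ### The operator systems `W_{n,k}` -/

/-- `ℓ^∞_{nk}`, with its coordinates arranged in `n` consecutive blocks of length `k`. -/
abbrev EllInf (n k : ℕ) : Type := Fin n × Fin k → ℂ

/-- The subspace of those vectors in `ℓ^∞_{nk}` whose `n` block sums are all equal. -/
def blockSpace (n k : ℕ) : Submodule ℂ (EllInf n k) where
  carrier := {a | ∀ i j : Fin n, ∑ l, a (i, l) = ∑ l, a (j, l)}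
  zero_mem' := by intro i j; simp
  add_mem' := by
    intro a b ha hb i j
    simp only [Pi.add_apply, Finset.sum_add_distrib, ha i j, hb i j]
  smul_mem' := by
    intro c a ha i j
    simp only [Pi.smul_apply, ← Finset.smul_sum, ha i j]

instance blockSpace.instStarAddMonoid (n k : ℕ) : StarAddMonoid (blockSpace n k) where
  star a := ⟨star a.1, fun i j => by
    simp only [Pi.star_apply, ← star_sum, a.2 i j]⟩
  star_involutive a := Subtype.ext (star_star a.1)
  star_add a b := Subtype.ext (star_add a.1 b.1)

instance blockSpace.instStarModule (n k : ℕ) : StarModule ℂ (blockSpace n k) where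
  star_smul c a := Subtype.ext (star_smul c a.1)

/-- The operator system structure of the block space as an operator subsystem of the C*-algebra
`ℓ^∞_{nk}`; the unit is the constant vector `1`. -/
noncomputable instance blockSpace.instOperatorSystem (n k : ℕ) : OperatorSystem (blockSpace n k) :=
  OperatorSystem.induced (blockSpace n k).subtype Subtype.val_injective (fun _ => rfl)
    ⟨1, fun i j => by simp⟩ (by rfl)

/-- The operator system spanned in `ℓ^∞_{2m}` by `w_0 = (1, …, 1)`, `w_1 = (1, -1, 0, …, 0)`,
`w_2 = (0, 0, 1, -1, 0, …, 0)`, …, `w_m = (0, …, 0, 1, -1)`: the vectors whose `m` consecutive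
pairs of coordinates all have the same sum. The second index is the number of blocks and the
first one is their length. -/
abbrev W₂ (m : ℕ) : Type := blockSpace m 2

/-! ### The order inclusion -/

/-- Positivity in the C*-algebra `ℓ^∞_N ⊗ A`. As `ℓ^∞_N` is finite-dimensional, this C*-algebra is
the algebraic tensor product, and its positive elements are those of the form `y* y`. -/
def IsTensorPositive {n k : ℕ} {A : Type*} [CStarAlgebra A] (x : EllInf n k ⊗[ℂ] A) : Prop :=
  ∃ y : EllInf n k ⊗[ℂ] A, x = star y * y

/-- The inclusion map `i ⊗ id : W_{2,m} ⊗ A → ℓ^∞_{2m} ⊗ A`. -/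
noncomputable def inclTensor (m : ℕ) (A : Type*) [CStarAlgebra A] :
    W₂ m ⊗[ℂ] A →ₗ[ℂ] EllInf m 2 ⊗[ℂ] A :=
  TensorProduct.map (blockSpace m 2).subtype LinearMap.id

/-- `W_{2,m} ⊗_max A ⊂ ℓ^∞_{2m} ⊗ A` order isomorphically: the map `i ⊗ id` is injective and an
element is positive in `W_{2,m} ⊗_max A` if and only if its image is positive. -/
def MaxOrderInclusion (m : ℕ) (A : Type*) [CStarAlgebra A] [PartialOrder A]
    [StarOrderedRing A] : Prop :=
  Function.Injective (inclTensor m A) ∧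
    ∀ u : W₂ m ⊗[ℂ] A, IsMaxPositive u ↔ IsTensorPositive (inclTensor m A u)

/-! ### The partition of unity property -/

/-- The strict order `a < b` of a unital C*-algebra: `b - a ≥ δ 1` for some scalar `δ > 0`. -/
def StrictlyBelow {A : Type*} [CStarAlgebra A] [PartialOrder A] (a b : A) : Prop :=
  ∃ δ : ℝ, 0 < δ ∧ (δ : ℂ) • (1 : A) ≤ b - a

/-- The `m`-partition of unity property of a unital C*-algebra. -/
def HasPartitionOfUnityProperty (m : ℕ) (A : Type*) [CStarAlgebra A] [PartialOrder A]
    [StarOrderedRing A] : Prop :=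
  ∀ b : Fin m → A, (∀ k, IsSelfAdjoint (b k)) →
    (∀ k, StrictlyBelow 0 (b k) ∧ StrictlyBelow (b k) 1) →
    ∃ (n : ℕ) (a : CStarMatrix (Fin n) (Fin n) A) (C : Fin m → CStarMatrix (Fin n) (Fin n) ℂ),
      0 < n ∧ 0 ≤ a ∧ ∑ i, a i i = 1 ∧
      (∀ k, StrictlyBelow 0 (C k) ∧ StrictlyBelow (C k) 1) ∧
      ∀ k, b k = ∑ i, ∑ j, C k i j • a i j

/-! An element of `W₂ m ⊗ A` is determined by its `2m` coordinates in `A`, whose sums over each pair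
agree. By `mem_maxPreCone_one_iff`, lying in the pre-cone means having the form `∑ s_ij ⊗ t_ij` with
`s` and `t` positive; here `s` is a family of positive scalar matrices with equal pair sums. A
partition of unity is such a representation with `s` given by the pairs `C_k`, `1 - C_k` and
coordinates `b_k`, `1 - b_k`. The two properties thus differ only by normalising the common sum `y`
and by strictness; conjugation by `y^{-1/2}` settles the former. If `A` has the property, adding `ε`
makes the coordinates strictly positive, and the conjugation takes place in `A`. Conversely, the
order inclusion represents `u` minus a multiple of the unit. `exists_strict_sum_tmul_of_add_unit`
puts part of that multiple into `s`, and the conjugation is now done on scalar matrices and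
transferred to `t` by `sum_conjugate_smul`. -/

/-! ### The strict order and normalisation by conjugation -/

section StrictOrder

variable {B : Type*} [CStarAlgebra B] [PartialOrder B] [StarOrderedRing B]

lemma strictlyBelow_iff_isStrictlyPositive {a b : B} :
    StrictlyBelow a b ↔ IsStrictlyPositive (b - a) := by
  constructor
  · rintro ⟨δ, hδ, h⟩
    have h1 : IsStrictlyPositive ((δ : ℂ) • (1 : B)) := by
      rw [Complex.coe_smul]
      exact IsStrictlyPositive.smul hδ isStrictlyPositive_one
    exact h1.of_le h
  · intro h
    -- The zero algebra has empty spectrum and any `δ` serves; otherwise the compact nonempty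
    -- spectrum gives a uniform lower bound.
    rcases subsingleton_or_nontrivial B with hB | hB
    · exact ⟨1, one_pos, (Subsingleton.elim _ _).le⟩
    obtain ⟨r, hr, hle⟩ := (CFC.exists_pos_algebraMap_le_iff h.isSelfAdjoint).2
      fun x hx => h.spectrum_pos hx
    refine ⟨r, hr, ?_⟩
    rwa [Complex.coe_smul, ← Algebra.algebraMap_eq_smul_one]

lemma StrictlyBelow.trans_isStrictlyPositive {x y : B} (h₀ : StrictlyBelow 0 x)
    (h₁ : StrictlyBelow x y) : IsStrictlyPositive y := by
  rw [strictlyBelow_iff_isStrictlyPositive, sub_zero] at h₀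
  rw [strictlyBelow_iff_isStrictlyPositive] at h₁
  simpa using h₀.add_nonneg h₁.nonneg

/-- Conjugation by the inverse square root of `y` turns the interval `0 < x < y` into
`0 < c < 1`. -/
lemma IsStrictlyPositive.exists_conjugate_strictlyBelow_one {y : B} (hy : IsStrictlyPositive y) :
    ∃ s : B, IsSelfAdjoint s ∧ s * s = y ∧ ∀ x, StrictlyBelow 0 x → StrictlyBelow x y →
      ∃ c, IsSelfAdjoint c ∧ x = s * c * s ∧ StrictlyBelow 0 c ∧ StrictlyBelow c 1 := by
  have hs : IsSelfAdjoint (CFC.sqrt y) := (CFC.sqrt_nonneg y).isSelfAdjoint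
  have hss : CFC.sqrt y * CFC.sqrt y = y := CFC.sqrt_mul_sqrt_self y hy.nonneg
  have hu : IsUnit (CFC.sqrt y) := hy.isUnit_cfcSqrt
  refine ⟨CFC.sqrt y, hs, hss, ?_⟩
  generalize CFC.sqrt y = s at hs hss hu
  lift s to Bˣ using hu
  intro x hx hxy
  -- With `c = s⁻¹xs⁻¹` one has `y - x = s(1 - c)s`, and conjugation by an invertible self-adjoint
  -- element preserves and reflects strict positivity.
  have hx' : x = (s : B) * ((↑s⁻¹ : B) * x * ↑s⁻¹) * s := by simp [mul_assoc]
  have hxy' : y - x = (s : B) * (1 - (↑s⁻¹ : B) * x * ↑s⁻¹) * s := by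
    rw [mul_sub, sub_mul, mul_one, hss, ← hx']
  simp only [strictlyBelow_iff_isStrictlyPositive, sub_zero] at hx hxy ⊢
  rw [hx', s.isUnit.isStrictlyPositive_iff_conjugate_of_isSelfAdjoint _ _ hs] at hx
  rw [hxy', s.isUnit.isStrictlyPositive_iff_conjugate_of_isSelfAdjoint _ _ hs] at hxy
  exact ⟨_, hx.isSelfAdjoint, hx', hx, hxy⟩

end StrictOrder

/-! ### The pre-cone at matrix level one -/

section MaxPreCone

variable {S T : Type*} [AddCommGroup S] [Module ℂ S] [StarAddMonoid S] [StarModule ℂ S]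
  [OperatorSystem S] [AddCommGroup T] [Module ℂ T] [StarAddMonoid T] [StarModule ℂ T]
  [OperatorSystem T]

/-- A `pq × 1` column reshapes into a `q × p` matrix, which can be absorbed into `t` by compression;
conversely the sum comes from the column that is the vectorised identity. -/
lemma mem_maxPreCone_one_iff {u : S ⊗[ℂ] T} :
    (Matrix.of fun _ _ => u) ∈ maxPreCone S T 1 ↔
      ∃ (n : ℕ) (s : Matrix (Fin n) (Fin n) S) (t : Matrix (Fin n) (Fin n) T),
        s ∈ OperatorSystem.cone n ∧ t ∈ OperatorSystem.cone n ∧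
          u = ∑ i, ∑ j, s i j ⊗ₜ[ℂ] t i j := by
  constructor
  · rintro ⟨p, q, s, t, X, hs, ht, h⟩
    refine ⟨p, s, compress (Matrix.of fun k i => X (i, k) 0) t, hs,
      OperatorSystem.compress_mem _ ht, ?_⟩
    have h' := congrFun (congrFun h 0) 0
    simp only [compress, Matrix.of_apply] at h' ⊢
    rw [h']
    simp only [Fintype.sum_prod_type, TensorProduct.tmul_sum, TensorProduct.tmul_smul]
    exact Finset.sum_congr rfl fun i _ => Finset.sum_comm
  · rintro ⟨n, s, t, hs, ht, rfl⟩
    refine ⟨n, n, s, t, Matrix.of fun i _ => if i.1 = i.2 then 1 else 0, hs, ht, ?_⟩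
    ext i j
    simp [compress, Fintype.sum_prod_type, ite_smul]

lemma isMaxPositive_iff {u : S ⊗[ℂ] T} :
    IsMaxPositive u ↔ ∀ ε : ℝ, 0 < ε →
      ∃ (n : ℕ) (s : Matrix (Fin n) (Fin n) S) (t : Matrix (Fin n) (Fin n) T),
        s ∈ OperatorSystem.cone n ∧ t ∈ OperatorSystem.cone n ∧
          u + (ε : ℂ) • (OperatorSystem.unit : S) ⊗ₜ[ℂ] (OperatorSystem.unit : T) =
            ∑ i, ∑ j, s i j ⊗ₜ[ℂ] t i j := by
  simp only [← mem_maxPreCone_one_iff]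
  refine forall₂_congr fun ε _ => ?_
  have : (Matrix.of fun _ _ => u : Matrix (Fin 1) (Fin 1) (S ⊗[ℂ] T)) + (ε : ℂ) •
      Matrix.diagonal (fun _ => (OperatorSystem.unit : S) ⊗ₜ[ℂ] (OperatorSystem.unit : T)) =
      Matrix.of fun _ _ => u + (ε : ℂ) • (OperatorSystem.unit : S) ⊗ₜ[ℂ]
        (OperatorSystem.unit : T) := by
    ext i j
    simp [Subsingleton.elim i j]
  rw [this]

end MaxPreCone

lemma Fintype.sum_rotate {M ι κ l : Type*} [AddCommMonoid M] [Fintype ι] [Fintype κ] [Fintype l]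
    (f : ι → κ → l → M) : ∑ i, ∑ j, ∑ k, f i j k = ∑ k, ∑ i, ∑ j, f i j k :=
  (Finset.sum_congr rfl fun _ _ => Finset.sum_comm).trans Finset.sum_comm

/-! ### Positive matrices and the pairing of scalar matrices with matrices over `A` -/

section MatrixCones

lemma ofMatrix_nonneg_iff_exists {A : Type*} [CStarAlgebra A] [PartialOrder A]
    [StarOrderedRing A] {n : ℕ} {x : Matrix (Fin n) (Fin n) A} :
    0 ≤ CStarMatrix.ofMatrix x ↔ ∃ y : Matrix (Fin n) (Fin n) A, x = y.conjTranspose * y := by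
  refine ⟨fun h => exists_eq_star_mul_self_of_nonneg h, ?_⟩
  rintro ⟨y, rfl⟩
  exact conjTranspose_mul_self_nonneg_of_rect y

/-- Factorisations `y* y` can be chosen coordinate by coordinate and reassembled. -/
lemma ofMatrix_nonneg_pi_iff {ι : Type*} [Fintype ι] {n : ℕ}
    {x : Matrix (Fin n) (Fin n) (ι → ℂ)} :
    0 ≤ CStarMatrix.ofMatrix x ↔
      ∀ p, 0 ≤ CStarMatrix.ofMatrix (Matrix.of fun i j => x i j p) := by
  simp only [ofMatrix_nonneg_iff_exists]
  constructor
  · rintro ⟨y, rfl⟩ p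
    exact ⟨Matrix.of fun i j => y i j p, by ext; simp [Matrix.mul_apply]⟩
  · intro h
    choose y hy using h
    refine ⟨Matrix.of fun i j p => y p i j, ?_⟩
    ext i j p
    simpa [Matrix.mul_apply] using congrFun (congrFun (hy p) i) j

lemma mem_cone_blockSpace_iff {m k n : ℕ} {s : Matrix (Fin n) (Fin n) (blockSpace m k)} :
    s ∈ OperatorSystem.cone n ↔
      ∀ p, 0 ≤ CStarMatrix.ofMatrix (Matrix.of fun i j => (s i j).1 p) :=
  ofMatrix_nonneg_pi_iff (x := s.map (blockSpace m k).subtype)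

variable {A : Type*} [CStarAlgebra A] [PartialOrder A] [StarOrderedRing A]

lemma mem_cone_iff_nonneg {n : ℕ} {t : Matrix (Fin n) (Fin n) A} :
    t ∈ OperatorSystem.cone n ↔ 0 ≤ CStarMatrix.ofMatrix t := Iff.rfl

lemma CStarMatrix.apply_self_nonneg {n : ℕ} {t : Matrix (Fin n) (Fin n) A}
    (ht : 0 ≤ CStarMatrix.ofMatrix t) (i : Fin n) : 0 ≤ t i i := by
  obtain ⟨y, rfl⟩ := ofMatrix_nonneg_iff_exists.mp ht
  simp only [Matrix.mul_apply, Matrix.conjTranspose_apply]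
  exact Finset.sum_nonneg fun k _ => star_mul_self_nonneg _

/-- Writing `c = y* y` turns the pairing into the trace of a compression of `t`. The pairing has no
transpose built in, so the compressing matrix is `yᵀ`. -/
lemma sum_smul_nonneg {n : ℕ} {c : Matrix (Fin n) (Fin n) ℂ} {t : Matrix (Fin n) (Fin n) A}
    (hc : 0 ≤ CStarMatrix.ofMatrix c) (ht : 0 ≤ CStarMatrix.ofMatrix t) :
    0 ≤ ∑ i, ∑ j, c i j • t i j := by
  obtain ⟨y, rfl⟩ := ofMatrix_nonneg_iff_exists.mp hc
  have h : ∑ i, ∑ j, (y.conjTranspose * y) i j • t i j = ∑ k, compress y.transpose t k k := by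
    simp only [compress, Matrix.of_apply, Matrix.mul_apply, Matrix.conjTranspose_apply,
      Matrix.transpose_apply, Finset.sum_smul]
    exact Fintype.sum_rotate _
  rw [h]
  exact Finset.sum_nonneg fun k _ => CStarMatrix.apply_self_nonneg
    (OperatorSystem.compress_mem y.transpose (mem_cone_iff_nonneg.mpr ht)) k

/-- Conjugating the scalar matrix by a self-adjoint `s` amounts to compressing the other one. -/
lemma sum_conjugate_smul {V : Type*} [AddCommGroup V] [Module ℂ V] {n : ℕ}
    {s : CStarMatrix (Fin n) (Fin n) ℂ} (hs : IsSelfAdjoint s)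
    (c : CStarMatrix (Fin n) (Fin n) ℂ) (t : Matrix (Fin n) (Fin n) V) :
    ∑ i, ∑ j, (s * c * s) i j • t i j =
      ∑ i, ∑ j, c i j • compress (Matrix.of fun i j => s j i) t i j := by
  have h : ∀ i j, star (s j i) = s i j := fun i j =>
    CStarMatrix.star_apply_of_isSelfAdjoint hs
  simp only [compress, Matrix.of_apply, CStarMatrix.mul_apply, h, Finset.sum_smul,
    Finset.smul_sum, Finset.sum_mul, smul_smul]
  symm
  rw [Fintype.sum_rotate]
  refine Finset.sum_congr rfl fun k _ => ?_
  rw [Fintype.sum_rotate]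
  refine Finset.sum_congr rfl fun l _ => ?_
  rw [Finset.sum_comm]
  refine Finset.sum_congr rfl fun j _ => Finset.sum_congr rfl fun i _ => ?_
  congr 1
  ring

lemma conjugate_diagonal_nonneg {n : ℕ} {a : CStarMatrix (Fin n) (Fin n) A} (ha : 0 ≤ a)
    (s : A) : 0 ≤ CStarMatrix.ofMatrix (Matrix.of fun i j => star s * a i j * s) := by
  obtain ⟨y, hy⟩ := exists_eq_star_mul_self_of_nonneg ha
  refine ofMatrix_nonneg_iff_exists.mpr ⟨Matrix.of fun i j => y i j * s, ?_⟩
  ext i j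
  have : a i j = ∑ k, star (y k i) * y k j := congrFun (congrFun hy i) j
  simp [this, Matrix.mul_apply, Finset.mul_sum, Finset.sum_mul, mul_assoc]

end MatrixCones

/-! ### Coordinates of the tensor products -/

section Evaluation

variable {m k : ℕ} {A : Type*} [CStarAlgebra A]

/-- Evaluation `ℓ^∞ ⊗ A → A` of the first tensor factor at the coordinate `p`. -/
noncomputable def tensorEval (p : Fin m × Fin k) : EllInf m k ⊗[ℂ] A →ₐ[ℂ] A :=
  Algebra.TensorProduct.lift (Algebra.ofId ℂ A |>.comp (Pi.evalAlgHom ℂ _ p)) (AlgHom.id ℂ A)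
    fun _ _ => Algebra.commutes _ _

@[simp] lemma tensorEval_tmul (p : Fin m × Fin k) (f : EllInf m k) (a : A) :
    tensorEval p (f ⊗ₜ[ℂ] a) = f p • a := by
  rw [tensorEval, Algebra.smul_def]
  exact Algebra.TensorProduct.lift_tmul _ _ _ f a

lemma tensorEval_star (p : Fin m × Fin k) (x : EllInf m k ⊗[ℂ] A) :
    tensorEval p (star x) = star (tensorEval p x) := by
  induction x with
  | zero => simp
  | tmul f a => simp
  | add x y hx hy => simp [hx, hy]

lemma eq_sum_single_tmul_tensorEval (x : EllInf m k ⊗[ℂ] A) :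
    x = ∑ p, (Pi.single p 1 : EllInf m k) ⊗ₜ[ℂ] tensorEval p x := by
  induction x with
  | zero => simp
  | tmul f a =>
    simp only [tensorEval_tmul, ← TensorProduct.smul_tmul, ← TensorProduct.sum_tmul]
    congr 1
    ext q
    simp [Finset.sum_apply, Pi.single_apply]
  | add x y hx hy =>
    conv_lhs => rw [hx, hy]
    simp [TensorProduct.tmul_add, Finset.sum_add_distrib]

lemma isTensorPositive_iff [PartialOrder A] [StarOrderedRing A] {x : EllInf m k ⊗[ℂ] A} :
    IsTensorPositive x ↔ ∀ p, 0 ≤ tensorEval p x := by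
  constructor
  · rintro ⟨y, rfl⟩ p
    rw [map_mul, tensorEval_star]
    exact star_mul_self_nonneg _
  · intro h
    choose y hy using fun p => exists_eq_star_mul_self_of_nonneg (h p)
    refine ⟨∑ p, (Pi.single p 1 : EllInf m k) ⊗ₜ[ℂ] y p, ?_⟩
    have key : ∀ q, tensorEval q (∑ p, (Pi.single p 1 : EllInf m k) ⊗ₜ[ℂ] y p) = y q := by
      intro q
      simp [Pi.single_apply]
    rw [eq_sum_single_tmul_tensorEval x, eq_sum_single_tmul_tensorEval (star _ * _)]
    simp only [map_mul, tensorEval_star, key, hy]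

lemma inclTensor_injective (m : ℕ) (A : Type*) [CStarAlgebra A] :
    Function.Injective (inclTensor m A) :=
  Module.Flat.rTensor_preserves_injective_linearMap (M := A) (blockSpace m 2).subtype
    Subtype.val_injective

/-- The coordinate of an element of `W_{2,m} ⊗ A` in `ℓ^∞_{2m} ⊗ A` at the index `p`. -/
noncomputable def tensorCoord (p : Fin m × Fin 2) : W₂ m ⊗[ℂ] A →ₗ[ℂ] A :=
  (tensorEval p).toLinearMap ∘ₗ inclTensor m A

@[simp] lemma tensorCoord_tmul (p : Fin m × Fin 2) (w : W₂ m) (a : A) :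
    tensorCoord p (w ⊗ₜ[ℂ] a) = w.1 p • a := by
  simp [tensorCoord, inclTensor]

lemma tensorCoord_ext {u v : W₂ m ⊗[ℂ] A} (h : ∀ p, tensorCoord p u = tensorCoord p v) :
    u = v := by
  refine inclTensor_injective m A ?_
  rw [eq_sum_single_tmul_tensorEval (inclTensor m A u),
    eq_sum_single_tmul_tensorEval (inclTensor m A v)]
  exact Finset.sum_congr rfl fun p _ => congrArg _ (h p)

/-- The defining relation of the block space passes to `A`-valued coordinates by linearity. -/
lemma tensorCoord_add_eq (u : W₂ m ⊗[ℂ] A) (i j : Fin m) :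
    tensorCoord (i, 0) u + tensorCoord (i, 1) u =
      tensorCoord (j, 0) u + tensorCoord (j, 1) u := by
  induction u with
  | zero => simp
  | tmul w a =>
    have h := w.2 i j
    simp only [Fin.sum_univ_two] at h
    simp [← add_smul, h]
  | add u v hu hv =>
    simp only [map_add]
    rw [add_add_add_comm, hu, hv, add_add_add_comm]

@[simp] lemma blockSpace_unit_apply {n k : ℕ} (p : Fin n × Fin k) :
    (OperatorSystem.unit : blockSpace n k).1 p = 1 := rfl

@[simp] lemma CStarAlgebra.operatorSystem_unit [PartialOrder A] [StarOrderedRing A] :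
    (OperatorSystem.unit : A) = 1 := rfl

/-- The vector of `W_{2,m}` with coordinates `c k` and `z - c k` in the `k`-th block. -/
def blockPair (z : ℂ) (c : Fin m → ℂ) : W₂ m :=
  ⟨fun p => ![c p.1, z - c p.1] p.2, fun i j => by simp⟩

@[simp] lemma blockPair_zero (z : ℂ) (c : Fin m → ℂ) (i : Fin m) :
    (blockPair z c).1 (i, 0) = c i := rfl

@[simp] lemma blockPair_one (z : ℂ) (c : Fin m → ℂ) (i : Fin m) :
    (blockPair z c).1 (i, 1) = z - c i := rfl

lemma exists_tensorCoord_eq (b : Fin m → A) :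
    ∃ u : W₂ m ⊗[ℂ] A, ∀ k, tensorCoord (k, 0) u = b k ∧ tensorCoord (k, 1) u = 1 - b k := by
  -- The first vector is `(0, 1)` in every block; the others are the `w_k`, which are `(1, -1)` in
  -- block `k` and zero elsewhere.
  refine ⟨blockPair 1 0 ⊗ₜ 1 + ∑ k, blockPair 0 (Pi.single k 1) ⊗ₜ b k, fun k => ⟨?_, ?_⟩⟩ <;>
  simp [Pi.single_apply, sub_eq_add_neg]

end Evaluation

/-! ### The two implications -/

section Main

variable {m : ℕ} {A : Type*} [CStarAlgebra A] [PartialOrder A] [StarOrderedRing A]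

omit [PartialOrder A] [StarOrderedRing A] in
lemma tensorCoord_sum_tmul {n : ℕ} (p : Fin m × Fin 2) (s : Matrix (Fin n) (Fin n) (W₂ m))
    (t : Matrix (Fin n) (Fin n) A) :
    tensorCoord p (∑ i, ∑ j, s i j ⊗ₜ[ℂ] t i j) = ∑ i, ∑ j, (s i j).1 p • t i j := by
  simp

lemma nonneg_of_forall_add_smul_one_nonneg {x : A}
    (h : ∀ ε : ℝ, 0 < ε → 0 ≤ x + (ε : ℂ) • (1 : A)) : 0 ≤ x := by
  have ht : Filter.Tendsto (fun ε : ℝ => x + (ε : ℂ) • (1 : A)) (nhdsWithin 0 (Set.Ioi 0))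
      (nhds x) := by
    have : Continuous (fun ε : ℝ => x + (ε : ℂ) • (1 : A)) := by fun_prop
    simpa using (this.tendsto 0).mono_left nhdsWithin_le_nhds
  exact CStarAlgebra.isClosed_nonneg.mem_of_tendsto ht (by
    filter_upwards [self_mem_nhdsWithin] with ε hε using h ε hε)

lemma IsMaxPositive.isTensorPositive {u : W₂ m ⊗[ℂ] A} (hu : IsMaxPositive u) :
    IsTensorPositive (inclTensor m A u) := by
  refine isTensorPositive_iff.mpr fun p => nonneg_of_forall_add_smul_one_nonneg fun ε hε => ?_
  obtain ⟨n, s, t, hs, ht, h⟩ := isMaxPositive_iff.mp hu ε hε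
  have h' := congrArg (tensorCoord p) h
  rw [tensorCoord_sum_tmul] at h'
  simp only [map_add, map_smul, tensorCoord_tmul, blockSpace_unit_apply,
    CStarAlgebra.operatorSystem_unit, one_smul] at h'
  change 0 ≤ tensorCoord p u + _
  rw [h']
  exact sum_smul_nonneg (mem_cone_blockSpace_iff.mp hs p) ht

lemma HasPartitionOfUnityProperty.isMaxPositive (hm : 1 ≤ m)
    (hA : HasPartitionOfUnityProperty m A) {u : W₂ m ⊗[ℂ] A}
    (hu : IsTensorPositive (inclTensor m A u)) : IsMaxPositive u := by
  refine isMaxPositive_iff.mpr fun ε hε => ?_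
  -- The `ε` allowed by the Archimedeanization makes every coordinate strictly positive.
  set v := u + (ε : ℂ) • (OperatorSystem.unit : W₂ m) ⊗ₜ[ℂ] (OperatorSystem.unit : A) with hv
  have hpos : ∀ p, StrictlyBelow 0 (tensorCoord p v) := by
    intro p
    refine ⟨ε, hε, ?_⟩
    have := isTensorPositive_iff.mp hu p
    change 0 ≤ tensorCoord p u at this
    simpa [hv] using this
  let i₀ : Fin m := ⟨0, hm⟩
  set y := tensorCoord (i₀, 0) v + tensorCoord (i₀, 1) v with hy
  have hadd : ∀ k, y - tensorCoord (k, 0) v = tensorCoord (k, 1) v := fun k => by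
    rw [hy, tensorCoord_add_eq v i₀ k, add_sub_cancel_left]
  have hlt : ∀ k, StrictlyBelow (tensorCoord (k, 0) v) y := fun k => by
    have := hpos (k, 1)
    rwa [← hadd, StrictlyBelow, sub_zero] at this
  obtain ⟨s, hs, hss, hc⟩ :=
    ((hpos (i₀, 0)).trans_isStrictlyPositive (hlt i₀)).exists_conjugate_strictlyBelow_one
  choose c hcsa hcx hc₀ hc₁ using fun k => hc _ (hpos (k, 0)) (hlt k)
  obtain ⟨n, a, C, -, ha, ha₁, hC, hb⟩ := hA c hcsa fun k => ⟨hc₀ k, hc₁ k⟩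
  -- The scalar coordinates are `C_k` and `1 - C_k`; conjugating `a` by `s = y^{1/2}` undoes the
  -- normalisation, since the trace of `a` becomes `s * s = y`.
  refine ⟨n, Matrix.of fun i j => blockPair ((1 : Matrix (Fin n) (Fin n) ℂ) i j)
    fun k => C k i j, Matrix.of fun i j => star s * a i j * s, ?_,
    mem_cone_iff_nonneg.mpr (conjugate_diagonal_nonneg ha s), ?_⟩
  · refine mem_cone_blockSpace_iff.mpr ?_
    rintro ⟨k, l⟩
    have h₀ := (strictlyBelow_iff_isStrictlyPositive.mp (hC k).1).nonneg
    rw [sub_zero] at h₀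
    have h₁ := (strictlyBelow_iff_isStrictlyPositive.mp (hC k).2).nonneg
    fin_cases l
    · exact h₀
    · exact h₁
  · have h₀ : ∀ k, tensorCoord (k, 0) v = ∑ i, ∑ j, C k i j • (star s * a i j * s) := by
      intro k
      rw [hcx k, hb k]
      simp [Finset.mul_sum, Finset.sum_mul, hs.star_eq]
    have h₁ : y = ∑ i, ∑ j, (1 : Matrix (Fin n) (Fin n) ℂ) i j • (star s * a i j * s) := by
      simp only [Matrix.one_apply, ite_smul, one_smul, zero_smul, Finset.sum_ite_eq,
        Finset.mem_univ, if_true]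
      rw [← Finset.sum_mul, ← Finset.mul_sum, ha₁, mul_one, hs.star_eq, hss]
    refine tensorCoord_ext ?_
    rintro ⟨k, l⟩
    rw [tensorCoord_sum_tmul]
    fin_cases l
    · simpa using h₀ k
    · have := hadd k
      rw [h₁, h₀ k] at this
      simp [← this, sub_smul]

/-- The `n × (n + 1)` matrix of the projection onto the first `n` coordinates. -/
def castSuccMatrix (n : ℕ) : Matrix (Fin n) (Fin (n + 1)) ℂ :=
  Matrix.of fun i j => if i.castSucc = j then 1 else 0

section CastSucc

variable {V : Type*} [AddCommGroup V] [Module ℂ V] {n : ℕ} (x : Matrix (Fin n) (Fin n) V)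

@[simp] lemma compress_castSuccMatrix_castSucc (i j : Fin n) :
    compress (castSuccMatrix n) x i.castSucc j.castSucc = x i j := by
  simp [compress, castSuccMatrix, ite_smul]

@[simp] lemma compress_castSuccMatrix_last_left (j : Fin (n + 1)) :
    compress (castSuccMatrix n) x (Fin.last n) j = 0 := by
  simp [compress, castSuccMatrix, Fin.castSucc_ne_last]

@[simp] lemma compress_castSuccMatrix_last_right (i : Fin (n + 1)) :
    compress (castSuccMatrix n) x i (Fin.last n) = 0 := by
  simp [compress, castSuccMatrix, Fin.castSucc_ne_last]

end CastSucc

lemma exists_pos_forall_smul_one_le {ι : Type*} [Finite ι] {x : ι → A}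
    (h : ∀ i, StrictlyBelow 0 (x i)) :
    ∃ ε : ℝ, 0 < ε ∧ ∀ i, (ε : ℂ) • (1 : A) ≤ x i := by
  have hev : ∀ i, ∀ᶠ ε : ℝ in nhdsWithin 0 (Set.Ioi 0), (ε : ℂ) • (1 : A) ≤ x i := by
    intro i
    obtain ⟨δ, hδ, hle⟩ := h i
    rw [sub_zero] at hle
    filter_upwards [Ioc_mem_nhdsGT hδ] with ε hε
    refine le_trans ?_ hle
    rw [Complex.coe_smul, Complex.coe_smul, ← Algebra.algebraMap_eq_smul_one,
      ← Algebra.algebraMap_eq_smul_one]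
    exact algebraMap_mono A hε.2
  obtain ⟨ε, h', hε⟩ := ((Filter.eventually_all.mpr hev).and self_mem_nhdsWithin).exists
  exact ⟨ε, hε, h'⟩

/-- An element of the pre-cone remains a finite sum `∑ s_{ij} ⊗ t_{ij}` after adding a multiple of
the unit, with `s` now bounded below by a multiple of the unit. -/
lemma exists_strict_sum_tmul_of_add_unit {n : ℕ} {s : Matrix (Fin n) (Fin n) (W₂ m)}
    {t : Matrix (Fin n) (Fin n) A} (hs : s ∈ OperatorSystem.cone n)
    (ht : t ∈ OperatorSystem.cone n) {ε : ℝ} (hε : 0 < ε) :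
    ∃ (s' : Matrix (Fin (n + 1)) (Fin (n + 1)) (W₂ m))
      (t' : Matrix (Fin (n + 1)) (Fin (n + 1)) A),
      (∀ p, StrictlyBelow 0 (CStarMatrix.ofMatrix (Matrix.of fun i j => (s' i j).1 p))) ∧
      t' ∈ OperatorSystem.cone (n + 1) ∧
      ∑ i, ∑ j, s i j ⊗ₜ[ℂ] t i j +
        (ε : ℂ) • (OperatorSystem.unit : W₂ m) ⊗ₜ[ℂ] (OperatorSystem.unit : A) =
        ∑ i, ∑ j, s' i j ⊗ₜ[ℂ] t' i j := by
  have hsa : IsSelfAdjoint (∑ i, t i i) :=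
    (Finset.sum_nonneg fun i _ => CStarMatrix.apply_self_nonneg ht i).isSelfAdjoint
  -- The added `1` keeps `M` positive, for the division `ε / M`, even when the trace vanishes.
  set M : ℝ := ‖∑ i, t i i‖ + 1 with hM
  have hMpos : 0 < M := by positivity
  have hr : 0 ≤ (M : ℂ) • (1 : A) - ∑ i, t i i := by
    rw [sub_nonneg, Complex.coe_smul, ← Algebra.algebraMap_eq_smul_one]
    refine hsa.le_algebraMap_norm_self.trans (algebraMap_mono A ?_)
    simp [hM]
  obtain ⟨r, hr'⟩ := exists_eq_star_mul_self_of_nonneg hr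
  have hη : 0 < ε / M := by positivity
  -- One extra diagonal entry `M - ∑ t_ii` makes the trace of `t'` the scalar `M`. It meets a zero
  -- entry of the enlarged `s`, so the tensor sum is unchanged.
  let R : Matrix (Fin 1) (Fin (n + 1)) A := Matrix.of fun _ j => if j = Fin.last n then r else 0
  set t' := compress (castSuccMatrix n) t + R.conjTranspose * R with ht'
  have hlast : (R.conjTranspose * R) (Fin.last n) (Fin.last n) =
      (M : ℂ) • (1 : A) - ∑ i, t i i := by
    rw [hr']
    simp [R, Matrix.mul_apply]
  have hzero : ∀ i j : Fin n, (R.conjTranspose * R) i.castSucc j.castSucc = 0 := by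
    simp [R, Matrix.mul_apply, Fin.castSucc_ne_last]
  have htr : ∑ i, t' i i = (M : ℂ) • (1 : A) := by
    simp only [ht', Fin.sum_univ_castSucc, Matrix.add_apply, compress_castSuccMatrix_castSucc,
      compress_castSuccMatrix_last_left, hlast, hzero, add_zero, zero_add, add_sub_cancel]
  have hsum : ∑ i, ∑ j, compress (castSuccMatrix n) s i j ⊗ₜ[ℂ] t' i j =
      ∑ i, ∑ j, s i j ⊗ₜ[ℂ] t i j := by
    simp [ht', Fin.sum_univ_castSucc, hzero]
  -- Adding `ε / M` on the diagonal of `s` contributes `(ε / M) 1 ⊗ ∑ t'_ii = ε (1 ⊗ 1)`.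
  refine ⟨compress (castSuccMatrix n) s +
      ((ε / M : ℝ) : ℂ) • Matrix.diagonal fun _ => OperatorSystem.unit,
    t', fun p => ?_, OperatorSystem.add_mem (OperatorSystem.compress_mem _ ht)
      (conjTranspose_mul_self_nonneg_of_rect R), ?_⟩
  · refine ⟨ε / M, hη, ?_⟩
    rw [sub_zero, ← sub_nonneg]
    refine (mem_cone_blockSpace_iff.mp (OperatorSystem.compress_mem (castSuccMatrix n) hs)
      p).trans_eq ?_
    ext i j
    by_cases hij : i = j <;> simp [hij]
  · have hdiag : ∀ i, ∑ j, (((ε / M : ℝ) : ℂ) • Matrix.diagonal fun _ =>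
        (OperatorSystem.unit : W₂ m)) i j ⊗ₜ[ℂ] t' i j =
        (((ε / M : ℝ) : ℂ) • (OperatorSystem.unit : W₂ m)) ⊗ₜ[ℂ] t' i i := by
      intro i
      rw [Finset.sum_eq_single i]
      · simp
      · intro j _ hj
        simp [Matrix.diagonal_apply_ne _ hj.symm]
      · simp
    have hεM : ((ε / M : ℝ) : ℂ) * (M : ℂ) = ε := by
      rw [← Complex.ofReal_mul, div_mul_cancel₀ _ hMpos.ne']
    simp only [Matrix.add_apply, TensorProduct.add_tmul, Finset.sum_add_distrib, hsum, hdiag]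
    rw [← TensorProduct.tmul_sum, htr, TensorProduct.tmul_smul, ← TensorProduct.smul_tmul',
      smul_smul, mul_comm, hεM, CStarAlgebra.operatorSystem_unit]

lemma MaxOrderInclusion.hasPartitionOfUnityProperty (hm : 1 ≤ m) (h : MaxOrderInclusion m A) :
    HasPartitionOfUnityProperty m A := by
  intro b hb hlt
  obtain ⟨u, hu⟩ := exists_tensorCoord_eq b
  obtain ⟨ε, hε, hle⟩ : ∃ ε : ℝ, 0 < ε ∧ ∀ p, (ε : ℂ) • (1 : A) ≤ tensorCoord p u := by
    refine exists_pos_forall_smul_one_le ?_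
    rintro ⟨k, l⟩
    fin_cases l
    · simpa [(hu k).1] using (hlt k).1
    · simpa [(hu k).2, StrictlyBelow] using (hlt k).2
  have hmax : IsMaxPositive (u - (ε : ℂ) • (OperatorSystem.unit : W₂ m) ⊗ₜ[ℂ]
      (OperatorSystem.unit : A)) := by
    refine (h.2 _).mpr (isTensorPositive_iff.mpr fun p => ?_)
    change 0 ≤ tensorCoord p _
    simpa using hle p
  -- Half of `ε` pays for entering the pre-cone, the other half for making `s` strictly positive.
  obtain ⟨n, s, t, hs, ht, hst⟩ := isMaxPositive_iff.mp hmax (ε / 2) (by positivity)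
  obtain ⟨s', t', hs', ht', hst'⟩ := exists_strict_sum_tmul_of_add_unit hs ht (half_pos hε)
  have hu' : u = ∑ i, ∑ j, s' i j ⊗ₜ[ℂ] t' i j := by
    rw [← hst', ← hst, add_assoc, ← add_smul, ← Complex.ofReal_add, add_halves, sub_add_cancel]
  let P : Fin m × Fin 2 → CStarMatrix (Fin (n + 1)) (Fin (n + 1)) ℂ :=
    fun p => CStarMatrix.ofMatrix (Matrix.of fun i j => (s' i j).1 p)
  have hP : ∀ p, tensorCoord p u = ∑ i, ∑ j, P p i j • t' i j := fun p => by
    rw [hu', tensorCoord_sum_tmul]; rfl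
  let i₀ : Fin m := ⟨0, hm⟩
  let y := P (i₀, 0) + P (i₀, 1)
  have hadd : ∀ k, y - P (k, 0) = P (k, 1) := fun k => by
    ext i j
    have := (s' i j).2 i₀ k
    simp only [Fin.sum_univ_two] at this
    exact sub_eq_of_eq_add' this
  have hPlt : ∀ k, StrictlyBelow (P (k, 0)) y := fun k => by
    have := hs' (k, 1)
    change StrictlyBelow 0 (P (k, 1)) at this
    rwa [← hadd, StrictlyBelow, sub_zero] at this
  obtain ⟨d, hd, hdd, hc⟩ :=
    ((hs' (i₀, 0)).trans_isStrictlyPositive (hPlt i₀)).exists_conjugate_strictlyBelow_one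
  choose C hCsa hCx hC₀ hC₁ using fun k => hc _ (hs' (k, 0)) (hPlt k)
  -- Once `y = d * d` is moved across the pairing, this sum is the trace of the compressed `t'`.
  have hone : ∑ i, ∑ j, y i j • t' i j = 1 := by
    have h₀ := hP (i₀, 0)
    have h₁ := hP (i₀, 1)
    have h₂ : tensorCoord (i₀, 0) u + tensorCoord (i₀, 1) u = 1 := by
      rw [(hu i₀).1, (hu i₀).2, add_sub_cancel]
    rw [← h₂, h₀, h₁]
    simp only [← Finset.sum_add_distrib, ← add_smul]
    rfl
  refine ⟨n + 1, CStarMatrix.ofMatrix (compress (Matrix.of fun i j => d j i) t'), C,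
    n.succ_pos, OperatorSystem.compress_mem _ ht', ?_, fun k => ⟨hC₀ k, hC₁ k⟩, fun k => ?_⟩
  · have := sum_conjugate_smul hd 1 t'
    rw [mul_one, hdd, hone] at this
    rw [this]
    simp [CStarMatrix.one_apply, ite_smul]
  · rw [← (hu k).1, hP (k, 0)]
    exact (congrArg (fun x : CStarMatrix (Fin (n + 1)) (Fin (n + 1)) ℂ =>
      ∑ i, ∑ j, x i j • t' i j) (hCx k)).trans (sum_conjugate_smul hd (C k) t')

end Main

theorem proposition3p1 (m : ℕ) (hm : 1 ≤ m) (A : Type*) [CStarAlgebra A] [PartialOrder A]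
    [StarOrderedRing A] :
    HasPartitionOfUnityProperty m A ↔ MaxOrderInclusion m A :=
  ⟨fun h => ⟨inclTensor_injective m A, fun _ =>
    ⟨IsMaxPositive.isTensorPositive, h.isMaxPositive hm⟩⟩,
    fun h => h.hasPartitionOfUnityProperty hm⟩
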